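/- An inversion sequence of length $n$ is an integer sequence $(a_1,\dots,a_n)$ with $0\le a_i<i$ for all $i$. Let $\mathcal I_n(\neq,\neq,\geq)$ be the set of inversion sequences of length $n$ for which there are no $i<j<k$ with $a_i\ne a_j$, $a_j\ne a_k$ and $a_i\ge a_k$. For every $n\ge 0$ this is the set of inversion sequences of length $n$ that avoid the patterns $010,101,120,201,210$ (a sequence avoids a pattern if none of its subsequences has entries in the same relative order, equalities included, as the pattern). Let $$F(z)=\sum_{n\ge0}|\mathcal I_n(\neq,\neq,\geq)|\,z^n .$$ Consider the kernel, a quartic in $x$, $$K(x)=x^4z^2-x^3z^2-2x^3z-x^2z^2+3x^2z+x^2-xz-2x+1 .$$ It has exactly two roots in $\mathbb R[[z]]$, which are distinct and have all coefficients in $\mathbb Q(\sqrt5)$, namely $$X_1=\frac{-\sqrt{-2(\sqrt5-3)z^2-4(\sqrt5+3)z+4}-\sqrt5\,z+z+2}{4z}=1+\tfrac12(1+\sqrt5)z+(2+\sqrt5)z^2+(7+3\sqrt5)z^3+(25+11\sqrt5)z^4+(96+43\sqrt5)z^5+\cdots,$$ $$X_3=\frac{-\sqrt{2(\sqrt5+3)z^2+4(\sqrt5-3)z+4}+\sqrt5\,z+z+2}{4z}=1+\tfrac12(1-\sqrt5)z+(2-\sqrt5)z^2+(7-3\sqrt5)z^3+(25-11\sqrt5)z^4+(96-43\sqrt5)z^5+\cdots,$$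 where the square roots denote the power series with constant term $2$. Then, in $\mathbb R[[z]]$ (the denominator below being invertible), $$F(z)=-\frac{X_1z+X_3z-1}{X_1X_3z^2-X_1z-X_3z-z+1} =1+z+2z^2+5z^3+15z^4+51z^5+188z^6+733z^7+2979z^8+12495z^9+53708z^{10}+\cdots .$$ Moreover $F$ is algebraic of degree $4$ over $\mathbb Q(z)$, and up to a factor in $\mathbb Q(z)$ its minimal polynomial is $$(4z^3-2z^2+z)B^4+(2z^3-7z^2+z-1)B^3-(z^3-10z^2+3z-3)B^2-(z^2+z+3)B+2z+1 .$$ -/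

import Mathlib

open scoped RatFunc

/-- An inversion sequence `(a₁, …, aₙ)`, `0 ≤ aᵢ < i`. Positions are indexed from `0` here, so the
condition reads `a i ≤ i`. -/
def IsInversionSeq {n : ℕ} (a : Fin n → ℕ) : Prop :=
  ∀ i : Fin n, a i ≤ (i : ℕ)

/-- `a` contains the pattern `σ`: some subsequence of `a` has its entries in the same relative
order as those of `σ` (equalities included, since `<` is compared in both directions). -/
def ContainsPattern {n k : ℕ} (a : Fin n → ℕ) (σ : Fin k → ℕ) : Prop :=
  ∃ f : Fin k ↪o Fin n, ∀ i j : Fin k, a (f i) < a (f j) ↔ σ i < σ j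

/-- Inversion sequences of length `n` that avoid every pattern in `S`. -/
def patternAvoiders (n : ℕ) {k : ℕ} (S : Set (Fin k → ℕ)) : Set (Fin n → ℕ) :=
  {a | IsInversionSeq a ∧ ∀ σ ∈ S, ¬ ContainsPattern a σ}

/-- Inversion sequences of length `n` that avoid the triple of binary relations `(ρ₁, ρ₂, ρ₃)`. -/
def relationAvoiders (n : ℕ) (ρ₁ ρ₂ ρ₃ : ℕ → ℕ → Prop) : Set (Fin n → ℕ) :=
  {a | IsInversionSeq a ∧
    ¬ ∃ i j k : Fin n, i < j ∧ j < k ∧ ρ₁ (a i) (a j) ∧ ρ₂ (a j) (a k) ∧ ρ₃ (a i) (a k)}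

theorem relationAvoiders_finite (n : ℕ) (ρ₁ ρ₂ ρ₃ : ℕ → ℕ → Prop) :
    (relationAvoiders n ρ₁ ρ₂ ρ₃).Finite :=
  (Set.finite_Iic (fun i : Fin n => (i : ℕ))).subset fun _ ha i => ha.1 i

/-- The set of inversion sequences of length `n` in the class `(≠, ≠, ≥)`. -/
def classNeNeGe (n : ℕ) : Set (Fin n → ℕ) :=
  relationAvoiders n (fun x y => x ≠ y) (fun x y => x ≠ y) (fun x y => x ≥ y)

/-- The ordinary generating function of the class `(≠, ≠, ≥)`, counted by length, as a power
series over `R`. -/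
noncomputable def genFunNeNeGe (R : Type*) [Semiring R] : PowerSeries R :=
  PowerSeries.mk fun n => ((classNeNeGe n).ncard : R)

/-- The quartic kernel
`x⁴z² - x³z² - 2x³z - x²z² + 3x²z + x² - xz - 2x + 1`, as a polynomial in `x` over `ℝ⟦z⟧`. -/
noncomputable def kernelPoly : Polynomial (PowerSeries ℝ) :=
  let x : Polynomial (PowerSeries ℝ) := Polynomial.X
  let z : Polynomial (PowerSeries ℝ) := Polynomial.C PowerSeries.X
  x ^ 4 * z ^ 2 - x ^ 3 * z ^ 2 - 2 * x ^ 3 * z - x ^ 2 * z ^ 2 + 3 * x ^ 2 * z + x ^ 2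
    - x * z - 2 * x + 1

/-- `(4z³ - 2z² + z)B⁴ + (2z³ - 7z² + z - 1)B³ - (z³ - 10z² + 3z - 3)B² - (z² + z + 3)B + 2z + 1`,
as a polynomial in `B` over `ℚ[z]`. -/
noncomputable def algEqNeNeGe : Polynomial (Polynomial ℚ) :=
  let B : Polynomial (Polynomial ℚ) := Polynomial.X
  let z : Polynomial (Polynomial ℚ) := Polynomial.C Polynomial.X
  (4 * z ^ 3 - 2 * z ^ 2 + z) * B ^ 4 + (2 * z ^ 3 - 7 * z ^ 2 + z - 1) * B ^ 3
    - (z ^ 3 - 10 * z ^ 2 + 3 * z - 3) * B ^ 2 - (z ^ 2 + z + 3) * B + (2 * z + 1)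

/-- The generating function over `ℚ`, viewed in the field of Laurent series `ℚ((z)) ⊇ ℚ(z)`. -/
noncomputable def genLaurentNeNeGe : LaurentSeries ℚ :=
  HahnSeries.ofPowerSeries ℤ ℚ (genFunNeNeGe ℚ)

/-!
Appending a letter to a sequence of the class only depends on two statistics, `t` (`headroom`) and
`e` (`gap`), so the class is a generating tree with root `(0, 0)` and succession rule
`(t, e) ↦ (t + 1, e), (t + 1, 0)ᵉ, (t, 0), (t - 1, 1), …, (0, t)`. The generating functions of its
subtrees are the unique solution of a linear recursion over the labels.

For `c ^ 2 = c + 1`, let `x` be the power series with `x = 1 + z x (x - 1 + c)` and write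
`x = 1 + c b`. Then `b (1 + e b) x ^ t` solves this recursion except for its inhomogeneous term,
which is affine in `t` instead of constant. The golden ratio and its conjugate provide two such
families, whose `x` are the two power-series roots of the kernel; in a suitable linear combination
the terms linear in `t` cancel, which yields `F`.

Eliminating the two roots gives the quartic equation of `F`. Its left-hand side is primitive, and
setting `z = 1` and reducing modulo `2` turns it into the fifth cyclotomic polynomial, which is
irreducible because `2` has order `4` modulo `5`.
-/

/-! ### The class as a pattern class -/

theorem containsPattern_three_iff {n : ℕ} {a : Fin n → ℕ} {x y z : ℕ} :
    ContainsPattern a ![x, y, z] ↔ ∃ i j k : Fin n, i < j ∧ j < k ∧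
      (a i < a j ↔ x < y) ∧ (a j < a i ↔ y < x) ∧ (a i < a k ↔ x < z) ∧ (a k < a i ↔ z < x) ∧
      (a j < a k ↔ y < z) ∧ (a k < a j ↔ z < y) := by
  constructor
  · rintro ⟨f, hf⟩
    exact ⟨f 0, f 1, f 2, f.strictMono (by decide), f.strictMono (by decide),
      hf 0 1, hf 1 0, hf 0 2, hf 2 0, hf 1 2, hf 2 1⟩
  · rintro ⟨i, j, k, hij, hjk, h01, h10, h02, h20, h12, h21⟩
    have hmono : StrictMono ![i, j, k] := by
      rw [Fin.strictMono_iff_lt_succ]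
      intro s
      fin_cases s
      exacts [hij, hjk]
    refine ⟨OrderEmbedding.ofStrictMono _ hmono, fun s t => ?_⟩
    fin_cases s <;> fin_cases t <;> simp [h01, h10, h02, h20, h12, h21]

theorem classNeNeGe_eq_patternAvoiders (n : ℕ) : classNeNeGe n =
    patternAvoiders n ({![0, 1, 0], ![1, 0, 1], ![1, 2, 0], ![2, 0, 1], ![2, 1, 0]} :
      Set (Fin 3 → ℕ)) := by
  ext a
  refine and_congr_right fun _ => ?_
  simp only [Set.mem_insert_iff, Set.mem_singleton_iff, forall_eq_or_imp, forall_eq,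
    containsPattern_three_iff]
  constructor
  · intro h
    refine ⟨?_, ?_, ?_, ?_, ?_⟩ <;>
    · rintro ⟨i, j, k, hij, hjk, hs⟩
      exact h ⟨i, j, k, hij, hjk, by omega, by omega, by omega⟩
  · rintro ⟨h010, h101, h120, h201, h210⟩ ⟨i, j, k, hij, hjk, hne₁, hne₂, hge⟩
    rcases hne₁.lt_or_gt with hlt | hgt
    · rcases hge.eq_or_lt with heq | hki
      · exact h010 ⟨i, j, k, hij, hjk, by omega⟩
      · exact h120 ⟨i, j, k, hij, hjk, by omega⟩
    · rcases hge.eq_or_lt with heq | hki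
      · exact h101 ⟨i, j, k, hij, hjk, by omega⟩
      · rcases hne₂.lt_or_gt with hjk' | hkj'
        · exact h201 ⟨i, j, k, hij, hjk, by omega⟩
        · exact h210 ⟨i, j, k, hij, hjk, by omega⟩

/-! ### The generating tree -/

section RelationAvoiders

variable {n : ℕ} {ρ₁ ρ₂ ρ₃ : ℕ → ℕ → Prop}

theorem snoc_mem_relationAvoiders_iff {a : Fin n → ℕ} {x : ℕ} :
    (Fin.snoc a x : Fin (n + 1) → ℕ) ∈ relationAvoiders (n + 1) ρ₁ ρ₂ ρ₃ ↔
      a ∈ relationAvoiders n ρ₁ ρ₂ ρ₃ ∧ x ≤ n ∧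
        ∀ i j, i < j → ρ₁ (a i) (a j) → ρ₂ (a j) x → ¬ ρ₃ (a i) x := by
  simp only [relationAvoiders, IsInversionSeq, Set.mem_ofPred_eq, not_exists, not_and,
    Fin.forall_fin_succ' (n := n), Fin.snoc_castSucc, Fin.snoc_last,
    Fin.castSucc_lt_castSucc_iff, Fin.castSucc_lt_last, Fin.val_castSucc, Fin.val_last,
    not_lt_of_ge (Fin.le_last _), true_imp_iff, false_imp_iff, imp_true_iff, and_true]
  grind

variable (n ρ₁ ρ₂ ρ₃) in
/-- `relationAvoiders` as a `Finset`, to be summed over. -/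
noncomputable def relationAvoidersFinset : Finset (Fin n → ℕ) :=
  (relationAvoiders_finite n ρ₁ ρ₂ ρ₃).toFinset

theorem mem_relationAvoidersFinset {a : Fin n → ℕ} :
    a ∈ relationAvoidersFinset n ρ₁ ρ₂ ρ₃ ↔ a ∈ relationAvoiders n ρ₁ ρ₂ ρ₃ :=
  Set.Finite.mem_toFinset _

open Classical in
theorem sum_relationAvoidersFinset_succ {M : Type*} [AddCommMonoid M]
    (f : (Fin (n + 1) → ℕ) → M) :
    ∑ b ∈ relationAvoidersFinset (n + 1) ρ₁ ρ₂ ρ₃, f b =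
      ∑ a ∈ relationAvoidersFinset n ρ₁ ρ₂ ρ₃,
        ∑ x ∈ Finset.range (n + 1) with
          (Fin.snoc a x : Fin (n + 1) → ℕ) ∈ relationAvoiders (n + 1) ρ₁ ρ₂ ρ₃,
          f (Fin.snoc a x) := by
  rw [Finset.sum_sigma']
  refine (Finset.sum_bij' (fun p _ => (Fin.snoc p.1 p.2 : Fin (n + 1) → ℕ))
    (fun b _ => ⟨Fin.init b, b (Fin.last n)⟩) ?_ ?_ ?_ ?_ ?_).symm
  · rintro ⟨a, x⟩ hp
    rw [Finset.mem_sigma, Finset.mem_filter] at hp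
    exact mem_relationAvoidersFinset.2 hp.2.2
  · intro b hb
    rw [mem_relationAvoidersFinset, ← Fin.snoc_init_self b] at hb
    obtain ⟨hinit, hlast, -⟩ := snoc_mem_relationAvoiders_iff.1 hb
    rw [Finset.mem_sigma, Finset.mem_filter, Finset.mem_range, mem_relationAvoidersFinset]
    exact ⟨hinit, Nat.lt_succ_of_le hlast, hb⟩
  all_goals simp

end RelationAvoiders

/-- The sum of `f` over the children of a node `(t, e)` in the generating tree with succession rule
`(t, e) ↦ (t + 1, e), (t + 1, 0)ᵉ, (t, 0), (t - 1, 1), …, (0, t)`. -/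
def childSum {M : Type*} [AddCommMonoid M] (f : ℕ → ℕ → M) (t e : ℕ) : M :=
  f (t + 1) e + e • f (t + 1) 0 + ∑ j ∈ Finset.range (t + 1), f (t - j) j

section SuccessionRule

variable {n : ℕ} {a : Fin (n + 1) → ℕ} {x : ℕ}

variable (a) in
/-- One more than the largest entry of `a` different from its last entry, and `0` if there is no
such entry. A letter other than the last entry can be appended exactly when it is at least this
threshold. -/
def appendThreshold : ℕ :=
  Finset.univ.sup fun i => if a i = a (Fin.last n) then 0 else a i + 1

theorem appendThreshold_le_iff :
    appendThreshold a ≤ x ↔ ∀ i, a i ≠ a (Fin.last n) → a i < x := by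
  simp only [appendThreshold, Finset.sup_le_iff, Finset.mem_univ, true_imp_iff]
  refine forall_congr' fun i => ?_
  split_ifs with h <;> simp [h]

theorem mem_classNeNeGe_iff {n : ℕ} {a : Fin n → ℕ} : a ∈ classNeNeGe n ↔
    IsInversionSeq a ∧ ∀ i j k, i < j → j < k → a i ≠ a j → a j ≠ a k → a i < a k := by
  simp only [classNeNeGe, relationAvoiders, Set.mem_ofPred_eq, not_exists, not_and, not_le,
    ge_iff_le]

theorem snoc_mem_classNeNeGe_iff :
    (Fin.snoc a x : Fin (n + 2) → ℕ) ∈ classNeNeGe (n + 2) ↔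
      a ∈ classNeNeGe (n + 1) ∧ x ≤ n + 1 ∧ (x = a (Fin.last n) ∨ appendThreshold a ≤ x) := by
  refine snoc_mem_relationAvoiders_iff.trans
    (and_congr_right fun ha => and_congr_right fun _ => ?_)
  have lt_last_of_ne {i : Fin (n + 1)} (hi : a i ≠ a (Fin.last n)) : i < Fin.last n :=
    Fin.lt_last_iff_ne_last.2 fun h => hi (congrArg a h)
  simp only [ge_iff_le, not_le, appendThreshold_le_iff]
  constructor
  · intro h
    refine or_iff_not_imp_left.2 fun hx i hi => ?_
    exact h i (Fin.last n) (lt_last_of_ne hi) hi (Ne.symm hx)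
  · intro h i j hij hne hjx
    have lt_last (hj : a j ≠ a (Fin.last n)) : a i < a (Fin.last n) :=
      (mem_classNeNeGe_iff.1 ha).2 i j _ hij (lt_last_of_ne hj) hne hj
    rcases h with rfl | h
    · exact lt_last hjx
    · exact h i fun hi => (lt_last fun hj => hne (hi.trans hj.symm)).ne hi

theorem appendThreshold_snoc_last :
    appendThreshold (Fin.snoc a (a (Fin.last n)) : Fin (n + 2) → ℕ) = appendThreshold a := by
  refine eq_of_forall_ge_iff fun y => ?_
  simp [appendThreshold_le_iff, Fin.forall_fin_succ' (n := n + 1)]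

theorem appendThreshold_snoc_of_ne (hx : x ≠ a (Fin.last n)) (h : appendThreshold a ≤ x) :
    appendThreshold (Fin.snoc a x : Fin (n + 2) → ℕ) =
      max (appendThreshold a) (a (Fin.last n) + 1) := by
  refine eq_of_forall_ge_iff fun y => ?_
  simp only [max_le_iff, Nat.succ_le_iff, appendThreshold_le_iff, Fin.forall_fin_succ' (n := n + 1),
    Fin.snoc_castSucc, Fin.snoc_last] at h ⊢
  grind

variable (a) in
/-- The number of letters that may be appended to `a` and exceed all its entries, minus one. -/
def headroom : ℕ :=
  n + 1 - max (appendThreshold a) (a (Fin.last n) + 1)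

variable (a) in
/-- The number of letters smaller than the last entry of `a` that may be appended to `a`. -/
def gap : ℕ :=
  a (Fin.last n) - appendThreshold a

theorem max_appendThreshold_le (ha : IsInversionSeq a) :
    max (appendThreshold a) (a (Fin.last n) + 1) ≤ n + 1 := by
  have lt_succ (i : Fin (n + 1)) : a i < n + 1 := (ha i).trans_lt i.is_lt
  exact max_le (appendThreshold_le_iff.2 fun i _ => lt_succ i) (lt_succ _)

open Classical in
theorem filter_snoc_mem_classNeNeGe (ha : a ∈ classNeNeGe (n + 1)) :
    {x ∈ Finset.range (n + 2) | (Fin.snoc a x : Fin (n + 2) → ℕ) ∈ classNeNeGe (n + 2)} =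
      insert (a (Fin.last n)) (Finset.Ico (appendThreshold a) (a (Fin.last n)) ∪
        Finset.Ico (max (appendThreshold a) (a (Fin.last n) + 1)) (n + 2)) := by
  have hmax := max_appendThreshold_le ha.1
  ext x
  simp only [Finset.mem_filter, Finset.mem_range, snoc_mem_classNeNeGe_iff, ha, true_and,
    Finset.mem_insert, Finset.mem_union, Finset.mem_Ico]
  omega

open Classical in
theorem sum_filter_snoc_mem_classNeNeGe {M : Type*} [AddCommMonoid M]
    (ha : a ∈ classNeNeGe (n + 1)) (f : ℕ → ℕ → M) :
    ∑ x ∈ Finset.range (n + 2) with (Fin.snoc a x : Fin (n + 2) → ℕ) ∈ classNeNeGe (n + 2),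
        f (headroom (Fin.snoc a x : Fin (n + 2) → ℕ)) (gap (Fin.snoc a x : Fin (n + 2) → ℕ)) =
      childSum f (headroom a) (gap a) := by
  have hmax := max_appendThreshold_le ha.1
  rw [filter_snoc_mem_classNeNeGe ha, Finset.sum_insert (by simp), Finset.sum_union, ← add_assoc]
  · refine congrArg₂ (· + ·) (congrArg₂ (· + ·) ?_ ?_) ?_
    · simp only [headroom, gap, appendThreshold_snoc_last, Fin.snoc_last]
      congr 1
      omega
    · rw [gap, ← Nat.card_Ico, ← Finset.sum_const]
      refine Finset.sum_congr rfl fun x hx => ?_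
      rw [Finset.mem_Ico] at hx
      rw [headroom, gap, appendThreshold_snoc_of_ne hx.2.ne hx.1, headroom, Fin.snoc_last]
      congr 1 <;> omega
    · rw [Finset.sum_Ico_eq_sum_range, headroom, ← Nat.sub_add_comm hmax]
      refine Finset.sum_congr rfl fun j _ => ?_
      rw [headroom, gap, appendThreshold_snoc_of_ne (by omega) (by omega), Fin.snoc_last]
      congr 1 <;> omega
  · rw [Finset.disjoint_left]
    intro x
    simp only [Finset.mem_Ico]
    omega

end SuccessionRule

/-- The number of nodes `l` generations below a node `(t, e)` of the generating tree. -/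
def descendantCount : ℕ → ℕ → ℕ → ℕ
  | 0, _, _ => 1
  | l + 1, t, e => childSum (descendantCount l) t e

theorem sum_descendantCount (l n : ℕ) :
    ∑ a ∈ relationAvoidersFinset (n + 1) (· ≠ ·) (· ≠ ·) (· ≥ ·),
      descendantCount l (headroom a) (gap a) = (classNeNeGe (n + 1 + l)).ncard := by
  induction l generalizing n with
  | zero =>
    simp only [descendantCount, Finset.sum_const, smul_eq_mul, mul_one]
    exact (Set.ncard_eq_toFinset_card _ _).symm
  | succ l ih =>
    classical
    rw [show n + 1 + (l + 1) = n + 1 + 1 + l by ring, ← ih,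
      sum_relationAvoidersFinset_succ (n := n + 1)]
    refine Finset.sum_congr rfl fun a ha => ?_
    have a_mem : a ∈ classNeNeGe (n + 1) := mem_relationAvoidersFinset.1 ha
    exact (sum_filter_snoc_mem_classNeNeGe a_mem (descendantCount l)).symm

theorem ncard_classNeNeGe_zero : (classNeNeGe 0).ncard = 1 := by
  refine Set.ncard_eq_one.2 ⟨Fin.elim0, Set.eq_singleton_iff_unique_mem.2
    ⟨mem_classNeNeGe_iff.2 ⟨fun i => i.elim0, fun i => i.elim0⟩, fun _ _ => Subsingleton.elim _ _⟩⟩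

theorem ncard_classNeNeGe_succ (l : ℕ) :
    (classNeNeGe (l + 1)).ncard = descendantCount l 0 0 := by
  have avoiders_one :
      relationAvoidersFinset (0 + 1) (· ≠ ·) (· ≠ ·) (· ≥ ·) = {fun _ => 0} := by
    refine Finset.eq_singleton_iff_unique_mem.2 ⟨?_, fun a ha => ?_⟩
    · exact mem_relationAvoidersFinset.2 (mem_classNeNeGe_iff.2 ⟨by simp [IsInversionSeq], by simp⟩)
    · ext i
      have := (mem_relationAvoidersFinset.1 ha).1 i
      omega
  rw [add_comm l 1, ← zero_add 1, ← sum_descendantCount l 0, avoiders_one,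
    Finset.sum_singleton]
  rfl

theorem ncard_classNeNeGe_initial : (List.range 11).map (fun n => (classNeNeGe n).ncard) =
    [1, 1, 2, 5, 15, 51, 188, 733, 2979, 12495, 53708] := by
  have descendants : (List.range 10).map (fun l => descendantCount l 0 0) =
      [1, 2, 5, 15, 51, 188, 733, 2979, 12495, 53708] := by
    decide +kernel
  rw [List.range_succ_eq_map, List.map_cons, List.map_map, ncard_classNeNeGe_zero, ← descendants]
  simp only [Function.comp_def, ncard_classNeNeGe_succ]

section TreeSeries

open PowerSeries

theorem map_childSum {M N F : Type*} [AddCommMonoid M] [AddCommMonoid N] [FunLike F M N]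
    [AddMonoidHomClass F M N] (φ : F) (f : ℕ → ℕ → M) (t e : ℕ) :
    φ (childSum f t e) = childSum (fun t e => φ (f t e)) t e := by
  simp only [childSum, map_add, map_nsmul, map_sum]

theorem childSum_sub {M : Type*} [AddCommGroup M] (f g : ℕ → ℕ → M) (t e : ℕ) :
    childSum (f - g) t e = childSum f t e - childSum g t e := by
  simp only [childSum, Pi.sub_apply, Finset.sum_sub_distrib, nsmul_sub]
  abel

theorem childSum_mul_left {R : Type*} [NonUnitalNonAssocSemiring R] (r : R) (f : ℕ → ℕ → R)
    (t e : ℕ) : childSum (fun t e => r * f t e) t e = r * childSum f t e :=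
  (map_childSum (AddMonoidHom.mulLeft r) f t e).symm

theorem eq_of_eq_add_X_mul_childSum {R : Type*} [Semiring R] {f g r : ℕ → ℕ → R⟦X⟧}
    (hf : ∀ t e, f t e = r t e + X * childSum f t e)
    (hg : ∀ t e, g t e = r t e + X * childSum g t e) : f = g := by
  funext t e
  ext n
  induction n generalizing t e with
  | zero => rw [hf, hg, map_add, map_add, coeff_zero_X_mul, coeff_zero_X_mul]
  | succ n ih =>
    rw [hf, hg, map_add, map_add, coeff_succ_X_mul, coeff_succ_X_mul, map_childSum, map_childSum]
    simp only [ih]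

/-- The generating function by generation of the nodes below a node `(t, e)` of the generating
tree. -/
noncomputable def treeSeries (R : Type*) [Semiring R] (t e : ℕ) : R⟦X⟧ :=
  mk fun l => (descendantCount l t e : R)

theorem treeSeries_eq (R : Type*) [Semiring R] (t e : ℕ) :
    treeSeries R t e = 1 + X * childSum (treeSeries R) t e := by
  ext l
  cases l with
  | zero => simp [treeSeries, descendantCount]
  | succ l =>
    rw [map_add, coeff_one, if_neg l.succ_ne_zero, zero_add, coeff_succ_X_mul, map_childSum]
    simp only [treeSeries, coeff_mk, descendantCount]
    exact map_childSum (Nat.castAddMonoidHom R) _ t e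

theorem genFunNeNeGe_eq_one_add (R : Type*) [Semiring R] :
    genFunNeNeGe R = 1 + X * treeSeries R 0 0 := by
  ext n
  cases n with
  | zero => simp [genFunNeNeGe, ncard_classNeNeGe_zero]
  | succ n =>
    simp [genFunNeNeGe, treeSeries, ncard_classNeNeGe_succ, coeff_succ_X_mul, coeff_one]

end TreeSeries

/-! ### The power-series roots of the kernel -/

section KernelRoot

open PowerSeries

variable {R : Type*} [CommRing R]

/-- The coefficients of `kernelRoot c`. -/
def kernelRootCoeff (c : R) : ℕ → R
  | 0 => 1
  | n + 1 => ∑ i : Fin (n + 1), kernelRootCoeff c i * kernelRootCoeff c (n - i) +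
      (c - 1) * kernelRootCoeff c n

/-- The power series `x` with `x = 1 + z x (x - 1 + c)`. It is a root of the kernel if `c` is the
golden ratio or its conjugate. -/
def kernelRoot (c : R) : R⟦X⟧ :=
  mk (kernelRootCoeff c)

theorem kernelRootCoeff_succ (c : R) (n : ℕ) : kernelRootCoeff c (n + 1) =
    ∑ i ∈ Finset.range (n + 1), kernelRootCoeff c i * kernelRootCoeff c (n - i) +
      (c - 1) * kernelRootCoeff c n := by
  rw [kernelRootCoeff, Finset.sum_range]

theorem coeff_kernelRoot (c : R) (n : ℕ) : coeff n (kernelRoot c) = kernelRootCoeff c n :=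
  coeff_mk _ _

theorem constantCoeff_kernelRoot (c : R) : constantCoeff (kernelRoot c) = 1 := by
  rw [← coeff_zero_eq_constantCoeff_apply, coeff_kernelRoot, kernelRootCoeff]

theorem kernelRoot_eq (c : R) :
    kernelRoot c = 1 + X * (kernelRoot c ^ 2 + (C c - 1) * kernelRoot c) := by
  ext n
  cases n with
  | zero => simp [constantCoeff_kernelRoot]
  | succ n =>
    rw [map_add, coeff_succ_X_mul, coeff_one, if_neg n.succ_ne_zero, zero_add, map_add,
      ← map_one C, ← map_sub, coeff_C_mul, sq, coeff_mul]
    simp only [coeff_kernelRoot]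
    rw [kernelRootCoeff_succ, Finset.Nat.sum_antidiagonal_eq_sum_range_succ
      (fun i j => kernelRootCoeff c i * kernelRootCoeff c j)]

theorem eq_kernelRoot_iff [IsDomain R] (c : R) {Y : R⟦X⟧} :
    Y = kernelRoot c ↔ Y = 1 + X * (Y ^ 2 + (C c - 1) * Y) := by
  refine ⟨fun h => h ▸ kernelRoot_eq c, fun hY => ?_⟩
  have h : (Y - kernelRoot c) * (1 - X * (Y + kernelRoot c + C c - 1)) = 0 := by
    linear_combination hY - kernelRoot_eq c
  rcases mul_eq_zero.1 h with h | h
  · exact sub_eq_zero.1 h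
  · simpa using congrArg constantCoeff h

theorem kernelRootCoeff_mem {S : Type*} [SetLike S R] [SubringClass S R] (s : S) {c : R}
    (hc : c ∈ s) (n : ℕ) : kernelRootCoeff c n ∈ s := by
  induction n using Nat.strong_induction_on with
  | _ n ih =>
    cases n with
    | zero =>
      rw [kernelRootCoeff]
      exact one_mem s
    | succ n =>
      rw [kernelRootCoeff]
      exact add_mem (sum_mem fun i _ => mul_mem (ih _ (by omega)) (ih _ (by omega)))
        (mul_mem (sub_mem hc (one_mem s)) (ih _ (by omega)))

theorem coeff_kernelRoot_mem {S : Type*} [SetLike S R] [SubringClass S R] {s : S} {c : R}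
    (hc : c ∈ s) (n : ℕ) : coeff n (kernelRoot c) ∈ s := by
  rw [coeff_kernelRoot]
  exact kernelRootCoeff_mem s hc n

theorem coeff_one_kernelRoot (c : R) : coeff 1 (kernelRoot c) = c := by
  simp [coeff_kernelRoot, kernelRootCoeff]

theorem coeff_kernelRoot_initial {c : R} (hc : c ^ 2 = c + 1) :
    (List.range 6).map (fun n => coeff n (kernelRoot c)) =
      [1, c, 1 + 2 * c, 4 + 6 * c, 14 + 22 * c, 53 + 86 * c] := by
  have x0 : kernelRootCoeff c 0 = 1 := by rw [kernelRootCoeff]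
  have x1 : kernelRootCoeff c 1 = c := by
    rw [kernelRootCoeff_succ]
    simp only [Finset.sum_range_succ, Finset.sum_range_zero, Nat.reduceSub, x0]
    ring
  have x2 : kernelRootCoeff c 2 = 1 + 2 * c := by
    rw [kernelRootCoeff_succ]
    simp only [Finset.sum_range_succ, Finset.sum_range_zero, Nat.reduceSub, x0, x1]
    linear_combination hc
  have x3 : kernelRootCoeff c 3 = 4 + 6 * c := by
    rw [kernelRootCoeff_succ]
    simp only [Finset.sum_range_succ, Finset.sum_range_zero, Nat.reduceSub, x0, x1, x2]
    linear_combination 3 * hc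
  have x4 : kernelRootCoeff c 4 = 14 + 22 * c := by
    rw [kernelRootCoeff_succ]
    simp only [Finset.sum_range_succ, Finset.sum_range_zero, Nat.reduceSub, x0, x1, x2, x3]
    linear_combination 10 * hc
  have x5 : kernelRootCoeff c 5 = 53 + 86 * c := by
    rw [kernelRootCoeff_succ]
    simp only [Finset.sum_range_succ, Finset.sum_range_zero, Nat.reduceSub, x0, x1, x2, x3, x4]
    linear_combination 38 * hc
  simp only [coeff_kernelRoot, List.range_succ, List.range_zero, List.map_cons,
    List.map_nil, List.nil_append, List.cons_append, x0, x1, x2, x3, x4, x5]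

/-- The square root of the discriminant of the quadratic equation of `kernelRoot c`. -/
noncomputable def kernelSqrt (c : R) : R⟦X⟧ :=
  2 - C (2 * (c - 1)) * X - 4 * X * kernelRoot c

theorem constantCoeff_kernelSqrt (c : R) : constantCoeff (kernelSqrt c) = 2 := by
  simp [kernelSqrt, map_ofNat]

theorem kernelSqrt_sq (c : R) :
    kernelSqrt c ^ 2 = C (4 * (c - 1) ^ 2) * X ^ 2 - C (8 * (c + 1)) * X + 4 := by
  simp only [kernelSqrt, map_mul, map_sub, map_add, map_pow, map_one, map_ofNat]
  linear_combination -16 * X * kernelRoot_eq c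

variable {c d : R}

theorem C_add_C_eq_one (hadd : c + d = 1) : (C c : R⟦X⟧) + C d = 1 := by
  rw [← map_add, hadd, map_one]

theorem C_mul_C_eq_neg_one (hmul : c * d = -1) : (C c : R⟦X⟧) * C d = -1 := by
  rw [← map_mul, hmul, map_neg, map_one]

end KernelRoot

section KernelPoly

open PowerSeries

theorem natDegree_kernelPoly : kernelPoly.natDegree = 4 := by
  have kernelPoly_eq : kernelPoly = Polynomial.C (X ^ 2) * Polynomial.X ^ 4 +
      Polynomial.C (-X ^ 2 - 2 * X) * Polynomial.X ^ 3 +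
      Polynomial.C (-X ^ 2 + 3 * X + 1) * Polynomial.X ^ 2 +
      Polynomial.C (-X - 2) * Polynomial.X + Polynomial.C 1 := by
    simp only [kernelPoly, map_neg, map_add, map_sub, map_mul, map_pow, map_ofNat, map_one]
    ring
  rw [kernelPoly_eq]
  compute_degree
  · exact pow_ne_zero 2 X_ne_zero
  all_goals norm_num

theorem eval_kernelPoly {c d : ℝ} (hadd : c + d = 1) (hmul : c * d = -1) (Y : ℝ⟦X⟧) :
    kernelPoly.eval Y =
      (Y - (1 + X * (Y ^ 2 + (C c - 1) * Y))) * (Y - (1 + X * (Y ^ 2 + (C d - 1) * Y))) := by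
  simp only [kernelPoly, Polynomial.eval_add, Polynomial.eval_sub, Polynomial.eval_mul,
    Polynomial.eval_pow, Polynomial.eval_X, Polynomial.eval_C, Polynomial.eval_ofNat,
    Polynomial.eval_one]
  linear_combination (X * Y * (Y - 1 - X * Y ^ 2) + X ^ 2 * Y ^ 2) * C_add_C_eq_one hadd -
    X ^ 2 * Y ^ 2 * C_mul_C_eq_neg_one hmul

theorem isRoot_kernelPoly_iff {c d : ℝ} (hadd : c + d = 1) (hmul : c * d = -1) (Y : ℝ⟦X⟧) :
    kernelPoly.IsRoot Y ↔ Y = kernelRoot c ∨ Y = kernelRoot d := by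
  rw [Polynomial.IsRoot.def, eval_kernelPoly hadd hmul, mul_eq_zero, sub_eq_zero, sub_eq_zero,
    eq_kernelRoot_iff, eq_kernelRoot_iff]

end KernelPoly

/-! ### The generating function in terms of the kernel roots -/

section GenFun

open PowerSeries

variable {R : Type*} [CommRing R]

theorem sum_range_mul_one_add_mul_pow {b c : R} (hc : c ^ 2 = c + 1) (t : ℕ) :
    ∑ j ∈ Finset.range (t + 1), b * (1 + j * b) * (1 + c * b) ^ (t - j) =
      (1 + c * b) ^ (t + 1) - 1 - (t + 1) * (c - 1) * b := by
  induction t with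
  | zero =>
    simp
    ring
  | succ t ih =>
    have pull : ∑ j ∈ Finset.range (t + 1), b * (1 + j * b) * (1 + c * b) ^ (t + 1 - j) =
        (1 + c * b) * ∑ j ∈ Finset.range (t + 1), b * (1 + j * b) * (1 + c * b) ^ (t - j) := by
      rw [Finset.mul_sum]
      refine Finset.sum_congr rfl fun j hj => ?_
      rw [Nat.sub_add_comm (Finset.mem_range_succ_iff.1 hj), pow_succ]
      ring
    rw [Finset.sum_range_succ, pull, ih, Nat.sub_self]
    push_cast
    linear_combination -(t + 1) * b ^ 2 * hc

/-- The series `b` with `kernelRoot c = 1 + c b` when `c² = c + 1`; it then satisfies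
`b = z (1 + b) (1 + c b)`. -/
noncomputable def ansatzBase (c : R) : R⟦X⟧ :=
  (C c - 1) * (kernelRoot c - 1)

/-- The family `b (1 + e b) x ^ t` with `x = kernelRoot c` and `b = (c - 1) (x - 1)`. For
`c² = c + 1` it satisfies the recursion of the generating tree up to a term affine in `t`. -/
noncomputable def ansatz (c : R) (t e : ℕ) : R⟦X⟧ :=
  ansatzBase c * (1 + e * ansatzBase c) * kernelRoot c ^ t

theorem ansatz_eq_add_X_mul_childSum {c : R} (hc : c ^ 2 = c + 1) (t e : ℕ) :
    ansatz c t e =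
      X * (1 + ((t : R⟦X⟧) + 1) * (C c - 1) * ansatzBase c) + X * childSum (ansatz c) t e := by
  have hC : (C c : R⟦X⟧) ^ 2 = C c + 1 := by rw [← map_pow, hc, map_add, map_one]
  have kernelRoot_eq_base : kernelRoot c = 1 + C c * ansatzBase c := by
    rw [ansatzBase]
    linear_combination (1 - kernelRoot c) * hC
  have base_eq : ansatzBase c = X * kernelRoot c * (1 + ansatzBase c) := by
    rw [ansatzBase]
    linear_combination (C c - 1) * kernelRoot_eq c + X * kernelRoot c * hC
  have geometric := sum_range_mul_one_add_mul_pow (b := ansatzBase c) hC t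
  rw [← kernelRoot_eq_base] at geometric
  simp only [childSum, ansatz, geometric, nsmul_eq_mul, Nat.cast_zero]
  linear_combination (1 + e * ansatzBase c) * kernelRoot c ^ t * base_eq

variable {c d : R}

theorem ansatzBase_sub_mul_treeSeries (hadd : c + d = 1) (hmul : c * d = -1) (t e : ℕ) :
    (C c * ansatzBase d - C d * ansatzBase c) * X * treeSeries R t e =
      C c * ansatzBase d * ansatz c t e - C d * ansatzBase c * ansatz d t e := by
  have hc := ansatz_eq_add_X_mul_childSum (c := c) (by linear_combination c * hadd - hmul)
  have hd := ansatz_eq_add_X_mul_childSum (c := d) (by linear_combination d * hadd - hmul)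
  refine congrFun₂ (eq_of_eq_add_X_mul_childSum
    (f := fun t e => (C c * ansatzBase d - C d * ansatzBase c) * X * treeSeries R t e)
    (g := (fun t e => C c * ansatzBase d * ansatz c t e) -
      fun t e => C d * ansatzBase c * ansatz d t e)
    (r := fun _ _ => (C c * ansatzBase d - C d * ansatzBase c) * X)
    (fun t e => ?_) fun t e => ?_) t e
  · rw [childSum_mul_left]
    linear_combination (C c * ansatzBase d - C d * ansatzBase c) * X * treeSeries_eq R t e
  · rw [childSum_sub, childSum_mul_left, childSum_mul_left, Pi.sub_apply, Pi.sub_apply]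
    linear_combination C c * ansatzBase d * hc t e - C d * ansatzBase c * hd t e +
      X * (t + 1) * ansatzBase c * ansatzBase d * (C c - C d) * C_add_C_eq_one hadd

theorem ansatzBase_sub_mul_genFunNeNeGe (hadd : c + d = 1) (hmul : c * d = -1) :
    (C c * ansatzBase d - C d * ansatzBase c) * genFunNeNeGe R =
      C c * ansatzBase d - C d * ansatzBase c + (C c - C d) * (ansatzBase c * ansatzBase d) := by
  have h := ansatzBase_sub_mul_treeSeries hadd hmul 0 0
  simp only [ansatz, Nat.cast_zero] at h
  rw [genFunNeNeGe_eq_one_add]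
  linear_combination h

theorem coeff_one_ansatzBase (c : R) : coeff 1 (ansatzBase c) = (c - 1) * c := by
  rw [ansatzBase, ← map_one C, ← map_sub, coeff_C_mul, map_sub, coeff_one_kernelRoot,
    coeff_C, if_neg one_ne_zero, sub_zero]

theorem ansatzBase_sub_ne_zero (hmul : c * d = -1) (hne : c ≠ d) :
    C c * ansatzBase d - C d * ansatzBase c ≠ 0 := by
  intro h
  have h1 := congrArg (coeff 1) h
  rw [map_sub, coeff_C_mul, coeff_C_mul, coeff_one_ansatzBase, coeff_one_ansatzBase, map_zero] at h1
  refine hne ?_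
  linear_combination h1 + (c - d) * hmul

-- In terms of `ansatzBase`, the left factors are the right-hand side of
-- `ansatzBase_sub_mul_genFunNeNeGe` and the factor that multiplies the generating function there.
theorem kernelRoots_fraction_identity {z x y : R} (hadd : c + d = 1) (hmul : c * d = -1)
    (hx : x = 1 + z * (x ^ 2 + (c - 1) * x)) (hy : y = 1 + z * (y ^ 2 + (d - 1) * y)) :
    (c * ((d - 1) * (y - 1)) - d * ((c - 1) * (x - 1)) +
        (c - d) * ((c - 1) * (x - 1) * ((d - 1) * (y - 1)))) * ((1 - z * x) * (1 - z * y) - z) =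
      (c * ((d - 1) * (y - 1)) - d * ((c - 1) * (x - 1))) * (1 - z * x - z * y) := by
  grind

-- `p / q` will be the generating function; its quartic equation appears here multiplied by `q ^ 4`.
theorem kernelRoots_quartic_identity {z x y : R} (hadd : c + d = 1) (hmul : c * d = -1)
    (hx : x = 1 + z * (x ^ 2 + (c - 1) * x)) (hy : y = 1 + z * (y ^ 2 + (d - 1) * y)) {p q : R}
    (hp : p = 1 - z * x - z * y) (hq : q = (1 - z * x) * (1 - z * y) - z) :
    (4 * z ^ 3 - 2 * z ^ 2 + z) * p ^ 4 + (2 * z ^ 3 - 7 * z ^ 2 + z - 1) * p ^ 3 * q -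
      (z ^ 3 - 10 * z ^ 2 + 3 * z - 3) * p ^ 2 * q ^ 2 - (z ^ 2 + z + 3) * p * q ^ 3 +
      (2 * z + 1) * q ^ 4 = 0 := by
  have hzx : z * x = z + (z * x) ^ 2 + (c - 1) * z * (z * x) := by linear_combination z * hx
  have hzy : z * y = z + (z * y) ^ 2 + (d - 1) * z * (z * y) := by linear_combination z * hy
  rw [hp, hq]
  clear hp hq
  generalize z * x = x', z * y = y' at hzx hzy ⊢
  grind

theorem genFunNeNeGe_mul [IsDomain R] (hadd : c + d = 1) (hmul : c * d = -1) (hne : c ≠ d) :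
    genFunNeNeGe R * ((1 - X * kernelRoot c) * (1 - X * kernelRoot d) - X) =
      1 - X * kernelRoot c - X * kernelRoot d := by
  refine mul_left_cancel₀ (ansatzBase_sub_ne_zero hmul hne) ?_
  rw [← mul_assoc, ansatzBase_sub_mul_genFunNeNeGe hadd hmul]
  exact kernelRoots_fraction_identity (C_add_C_eq_one hadd) (C_mul_C_eq_neg_one hmul)
    (kernelRoot_eq c) (kernelRoot_eq d)

theorem constantCoeff_denominator (x y : R⟦X⟧) :
    constantCoeff ((1 - X * x) * (1 - X * y) - X) = 1 := by
  simp

theorem genFunNeNeGe_quartic [IsDomain R] (hadd : c + d = 1) (hmul : c * d = -1) (hne : c ≠ d) :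
    (4 * X ^ 3 - 2 * X ^ 2 + X) * genFunNeNeGe R ^ 4 +
      (2 * X ^ 3 - 7 * X ^ 2 + X - 1) * genFunNeNeGe R ^ 3 -
      (X ^ 3 - 10 * X ^ 2 + 3 * X - 3) * genFunNeNeGe R ^ 2 -
      (X ^ 2 + X + 3) * genFunNeNeGe R + (2 * X + 1) = 0 := by
  have denominator_ne_zero : (1 - X * kernelRoot c) * (1 - X * kernelRoot d) - X ≠ 0 := fun h => by
    simpa [constantCoeff_denominator] using congrArg constantCoeff h
  refine (mul_eq_zero_iff_right (pow_ne_zero 4 denominator_ne_zero)).1 ?_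
  rw [← kernelRoots_quartic_identity (C_add_C_eq_one hadd) (C_mul_C_eq_neg_one hmul)
    (kernelRoot_eq c) (kernelRoot_eq d) (genFunNeNeGe_mul hadd hmul hne) rfl]
  ring

theorem genFunNeNeGe_eq_neg_mul_inv {K : Type*} [Field K] {c d : K} (hadd : c + d = 1)
    (hmul : c * d = -1) (hne : c ≠ d) : genFunNeNeGe K =
      -((kernelRoot c * X + kernelRoot d * X - 1) * (kernelRoot c * kernelRoot d * X ^ 2 -
        kernelRoot c * X - kernelRoot d * X - X + 1)⁻¹) := by
  have denominator_eq : kernelRoot c * kernelRoot d * X ^ 2 - kernelRoot c * X - kernelRoot d * X -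
      X + 1 = (1 - X * kernelRoot c) * (1 - X * kernelRoot d) - X := by ring
  rw [denominator_eq, ← neg_mul, PowerSeries.eq_mul_inv_iff_mul_eq
    (by rw [constantCoeff_denominator]; exact one_ne_zero), genFunNeNeGe_mul hadd hmul hne]
  ring

end GenFun

/-! ### The two golden kernel roots -/

section GoldenRoots

open PowerSeries
open scoped goldenRatio

theorem sqrt_five_sq : (√5 : ℝ) ^ 2 = 5 :=
  Real.sq_sqrt (by norm_num)

theorem goldenRatio_ne_goldenConj : φ ≠ ψ :=
  (Real.goldenConj_neg.trans Real.goldenRatio_pos).ne'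

theorem kernelRoot_goldenRatio_ne_kernelRoot_goldenConj : kernelRoot φ ≠ kernelRoot ψ := fun h =>
  goldenRatio_ne_goldenConj (by simpa only [coeff_one_kernelRoot] using congrArg (coeff 1) h)

theorem goldenRatio_mem_adjoin_sqrt_five : φ ∈ IntermediateField.adjoin ℚ {(√5 : ℝ)} :=
  div_mem (add_mem (one_mem _) (IntermediateField.mem_adjoin_simple_self ℚ _)) (ofNat_mem _ 2)

theorem goldenConj_mem_adjoin_sqrt_five : ψ ∈ IntermediateField.adjoin ℚ {(√5 : ℝ)} :=
  div_mem (sub_mem (one_mem _) (IntermediateField.mem_adjoin_simple_self ℚ _)) (ofNat_mem _ 2)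

theorem coeff_kernelRoot_goldenRatio_initial :
    (List.range 6).map (fun n => coeff n (kernelRoot φ)) =
      [1, 1 / 2 * (1 + √5), 2 + √5, 7 + 3 * √5, 25 + 11 * √5, 96 + 43 * √5] := by
  rw [coeff_kernelRoot_initial Real.goldenRatio_sq, Real.goldenRatio]
  ring_nf

theorem coeff_kernelRoot_goldenConj_initial :
    (List.range 6).map (fun n => coeff n (kernelRoot ψ)) =
      [1, 1 / 2 * (1 - √5), 2 - √5, 7 - 3 * √5, 25 - 11 * √5, 96 - 43 * √5] := by
  rw [coeff_kernelRoot_initial Real.goldenConj_sq, Real.goldenConj]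
  ring_nf

theorem kernelSqrt_goldenRatio_sq : kernelSqrt φ ^ 2 =
    C (-2 * (√5 - 3)) * X ^ 2 - C (4 * (√5 + 3)) * X + 4 := by
  have sq_coeff : 4 * (φ - 1) ^ 2 = -2 * (√5 - 3) := by
    rw [Real.goldenRatio]
    linear_combination sqrt_five_sq
  have linear_coeff : 8 * (φ + 1) = 4 * (√5 + 3) := by
    rw [Real.goldenRatio]
    ring
  rw [kernelSqrt_sq, sq_coeff, linear_coeff]

theorem kernelSqrt_goldenConj_sq : kernelSqrt ψ ^ 2 =
    C (2 * (√5 + 3)) * X ^ 2 + C (4 * (√5 - 3)) * X + 4 := by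
  have sq_coeff : 4 * (ψ - 1) ^ 2 = 2 * (√5 + 3) := by
    rw [Real.goldenConj]
    linear_combination sqrt_five_sq
  have linear_coeff : 8 * (ψ + 1) = -(4 * (√5 - 3)) := by
    rw [Real.goldenConj]
    ring
  rw [kernelSqrt_sq, sq_coeff, linear_coeff, map_neg, neg_mul, sub_neg_eq_add]

theorem four_mul_X_mul_kernelRoot_goldenRatio :
    4 * X * kernelRoot φ = -kernelSqrt φ - C √5 * X + X + 2 := by
  have linear_coeff : 2 * (φ - 1) = √5 - 1 := by
    rw [Real.goldenRatio]
    ring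
  rw [kernelSqrt, linear_coeff, map_sub, map_one]
  ring

theorem four_mul_X_mul_kernelRoot_goldenConj :
    4 * X * kernelRoot ψ = -kernelSqrt ψ + C √5 * X + X + 2 := by
  have linear_coeff : 2 * (ψ - 1) = -√5 - 1 := by
    rw [Real.goldenConj]
    ring
  rw [kernelSqrt, linear_coeff, map_sub, map_neg, map_one]
  ring

end GoldenRoots

/-! ### The algebraic equation over `ℚ(z)` -/

section Irreducibility

open Polynomial

theorem isPrimitive_of_isCoprime_coeff {R : Type*} [CommSemiring R] {p : R[X]} {i j : ℕ}
    (h : IsCoprime (p.coeff i) (p.coeff j)) : p.IsPrimitive := by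
  intro r hr
  rw [C_dvd_iff_dvd_coeff] at hr
  exact h.isUnit_of_dvd' (hr i) (hr j)

theorem irreducible_of_isPrimitive_of_irreducible_map {R S : Type*} [CommRing R] [IsDomain R]
    [CommRing S] [IsDomain S] (φ : R →+* S) {f : R[X]} (hf : f.IsPrimitive)
    (hlead : φ f.leadingCoeff ≠ 0) (h : Irreducible (f.map φ)) : Irreducible f := by
  have isUnit_of_isUnit_map {a b : R[X]} (hab : f = a * b) (ha : IsUnit (a.map φ)) :
      IsUnit a := by
    have lead_ne_zero : φ a.leadingCoeff ≠ 0 := by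
      rw [hab, leadingCoeff_mul, map_mul] at hlead
      exact left_ne_zero_of_mul hlead
    have natDegree_eq_zero : a.natDegree = 0 := by
      rw [← natDegree_map_of_leadingCoeff_ne_zero φ lead_ne_zero]
      exact natDegree_eq_zero_of_isUnit ha
    rw [eq_C_of_natDegree_eq_zero natDegree_eq_zero] at hab ⊢
    exact isUnit_C.2 (hf _ ⟨b, hab⟩)
  refine ⟨fun hu => h.not_isUnit (hu.map (mapRingHom φ)), fun a b hab => ?_⟩
  exact (h.isUnit_or_isUnit (by rw [hab, Polynomial.map_mul])).imp (isUnit_of_isUnit_map hab)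
    (isUnit_of_isUnit_map (hab.trans (mul_comm a b)))

theorem irreducible_cyclotomic_five_zmod_two : Irreducible (cyclotomic 5 (ZMod 2)) := by
  refine ZMod.irreducible_of_dvd_cyclotomic_of_natDegree (p := 2) (n := 5) (by decide) dvd_rfl ?_
  rw [natDegree_cyclotomic, Nat.totient_prime (by norm_num)]
  exact (orderOf_eq_prime_pow (p := 2) (n := 1) (by decide) (by decide)).symm

/-- The specialization of `algEqNeNeGe` at `z = 1`. -/
noncomputable def specializedQuartic : ℤ[X] :=
  C 3 * X ^ 4 + C (-5) * X ^ 3 + C 9 * X ^ 2 + C (-5) * X + C 3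

theorem isPrimitive_specializedQuartic : specializedQuartic.IsPrimitive := by
  refine isPrimitive_of_isCoprime_coeff (i := 0) (j := 1) ⟨2, 1, ?_⟩
  simp [specializedQuartic, coeff_X]

theorem leadingCoeff_specializedQuartic : specializedQuartic.leadingCoeff = 3 := by
  have natDegree_eq : specializedQuartic.natDegree = 4 := by
    rw [specializedQuartic]
    compute_degree!
  rw [leadingCoeff, natDegree_eq]
  simp [specializedQuartic, coeff_X]

theorem map_specializedQuartic_zmod_two :
    specializedQuartic.map (Int.castRingHom (ZMod 2)) = cyclotomic 5 (ZMod 2) := by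
  have : Fact (Nat.Prime 5) := ⟨by norm_num⟩
  have three : Int.castRingHom (ZMod 2) 3 = 1 := by decide
  have neg_five : Int.castRingHom (ZMod 2) (-5) = 1 := by decide
  have nine : Int.castRingHom (ZMod 2) 9 = 1 := by decide
  simp only [specializedQuartic, cyclotomic_prime, Finset.sum_range_succ, Finset.sum_range_zero,
    Polynomial.map_add, Polynomial.map_mul, Polynomial.map_pow, map_X, map_C, three, neg_five, nine,
    C_1]
  ring

theorem irreducible_specializedQuartic : Irreducible specializedQuartic := by
  refine irreducible_of_isPrimitive_of_irreducible_map (Int.castRingHom (ZMod 2))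
    isPrimitive_specializedQuartic ?_ ?_
  · rw [leadingCoeff_specializedQuartic]
    decide
  · rw [map_specializedQuartic_zmod_two]
    exact irreducible_cyclotomic_five_zmod_two

theorem map_algEqNeNeGe_evalRingHom_one :
    algEqNeNeGe.map (evalRingHom 1) = specializedQuartic.map (Int.castRingHom ℚ) := by
  simp only [algEqNeNeGe, specializedQuartic, Polynomial.map_add, Polynomial.map_sub,
    Polynomial.map_mul, Polynomial.map_pow, map_X, map_C, Polynomial.map_ofNat, Polynomial.map_one,
    coe_evalRingHom, eval_X, map_neg, Polynomial.map_neg, map_ofNat, map_one]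
  ring

theorem algEqNeNeGe_eq : algEqNeNeGe =
    C (4 * X ^ 3 - 2 * X ^ 2 + X) * X ^ 4 + C (2 * X ^ 3 - 7 * X ^ 2 + X - 1) * X ^ 3 +
      C (-(X ^ 3 - 10 * X ^ 2 + 3 * X - 3)) * X ^ 2 + C (-(X ^ 2 + X + 3)) * X + C (2 * X + 1) := by
  simp only [algEqNeNeGe, map_neg, map_add, map_sub, map_mul, map_pow, map_ofNat, map_one]
  ring

theorem leadingPoly_ne_zero : (4 * X ^ 3 - 2 * X ^ 2 + X : ℚ[X]) ≠ 0 := fun h =>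
  absurd (congrArg (eval 1) h) (by norm_num)

theorem natDegree_algEqNeNeGe : algEqNeNeGe.natDegree = 4 := by
  rw [algEqNeNeGe_eq]
  compute_degree
  · exact leadingPoly_ne_zero
  all_goals norm_num

theorem leadingCoeff_algEqNeNeGe : algEqNeNeGe.leadingCoeff = 4 * X ^ 3 - 2 * X ^ 2 + X := by
  rw [leadingCoeff, natDegree_algEqNeNeGe, algEqNeNeGe_eq]
  simp only [coeff_add, coeff_C_mul, coeff_X_pow, coeff_X, coeff_C]
  norm_num

theorem isPrimitive_algEqNeNeGe : algEqNeNeGe.IsPrimitive := by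
  have coeff_zero : algEqNeNeGe.coeff 0 = 2 * X + 1 := by
    simp [algEqNeNeGe_eq, coeff_X, -map_add, -map_sub, -map_neg, -map_mul]
  have coeff_one : algEqNeNeGe.coeff 1 = -(X ^ 2 + X + 3) := by
    simp [algEqNeNeGe_eq, coeff_C, -map_add, -map_sub, -map_neg, -map_mul, -neg_add_rev]
  have bezout : IsCoprime (2 * X + 1 : ℚ[X]) (-(X ^ 2 + X + 3)) := by
    have inv_mul_eleven : (C 11⁻¹ * 11 : ℚ[X]) = 1 := by
      rw [← C_ofNat, ← C_mul, inv_mul_cancel₀ (by norm_num), C_1]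
    exact ⟨-C 11⁻¹ * (2 * X + 1), -C 11⁻¹ * 4, by linear_combination inv_mul_eleven⟩
  rw [← coeff_zero, ← coeff_one] at bezout
  exact isPrimitive_of_isCoprime_coeff bezout

theorem irreducible_algEqNeNeGe : Irreducible algEqNeNeGe := by
  refine irreducible_of_isPrimitive_of_irreducible_map (evalRingHom 1) isPrimitive_algEqNeNeGe ?_ ?_
  · rw [leadingCoeff_algEqNeNeGe]
    norm_num
  · rw [map_algEqNeNeGe_evalRingHom_one]
    exact (IsPrimitive.Int.irreducible_iff_irreducible_map_cast isPrimitive_specializedQuartic).1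
      irreducible_specializedQuartic

end Irreducibility

section MinimalPolynomial

theorem map_genFunNeNeGe {R S : Type*} [Semiring R] [Semiring S] (φ : R →+* S) :
    PowerSeries.map φ (genFunNeNeGe R) = genFunNeNeGe S := by
  ext n
  simp [genFunNeNeGe]

open PowerSeries in
theorem genFunNeNeGe_rat_quartic :
    (4 * X ^ 3 - 2 * X ^ 2 + X) * genFunNeNeGe ℚ ^ 4 +
      (2 * X ^ 3 - 7 * X ^ 2 + X - 1) * genFunNeNeGe ℚ ^ 3 -
      (X ^ 3 - 10 * X ^ 2 + 3 * X - 3) * genFunNeNeGe ℚ ^ 2 -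
      (X ^ 2 + X + 3) * genFunNeNeGe ℚ + (2 * X + 1) = 0 := by
  refine PowerSeries.map_injective (algebraMap ℚ ℝ) (algebraMap ℚ ℝ).injective ?_
  simp only [map_add, map_sub, map_mul, map_pow, map_one, map_ofNat, map_zero, PowerSeries.map_X,
    map_genFunNeNeGe]
  exact genFunNeNeGe_quartic Real.goldenRatio_add_goldenConj Real.goldenRatio_mul_goldenConj
    goldenRatio_ne_goldenConj

open Polynomial

theorem aeval_genLaurentNeNeGe :
    aeval genLaurentNeNeGe (algEqNeNeGe.map (algebraMap ℚ[X] ℚ⟮X⟯)) = 0 := by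
  have algebraMap_X : algebraMap ℚ[X] (LaurentSeries ℚ) X =
      HahnSeries.ofPowerSeries ℤ ℚ PowerSeries.X := by
    simp
  have h := congrArg (HahnSeries.ofPowerSeries ℤ ℚ) genFunNeNeGe_rat_quartic
  simp only [map_add, map_sub, map_mul, map_pow, map_one, map_ofNat, map_zero, ← algebraMap_X] at h
  rw [aeval_map_algebraMap]
  simp only [algEqNeNeGe, map_add, map_sub, map_mul, map_pow, map_one, map_ofNat, aeval_X, aeval_C]
  exact h

theorem algebraMap_leadingPoly_ne_zero :
    algebraMap ℚ[X] ℚ⟮X⟯ (4 * X ^ 3 - 2 * X ^ 2 + X) ≠ 0 :=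
  (map_ne_zero_iff _ (IsFractionRing.injective _ _)).2 leadingPoly_ne_zero

theorem map_algEqNeNeGe_eq_C_mul_minpoly : algEqNeNeGe.map (algebraMap ℚ[X] ℚ⟮X⟯) =
    C (algebraMap ℚ[X] ℚ⟮X⟯ (4 * X ^ 3 - 2 * X ^ 2 + X)) * minpoly ℚ⟮X⟯ genLaurentNeNeGe := by
  have irreducible_map : Irreducible (algEqNeNeGe.map (algebraMap ℚ[X] ℚ⟮X⟯)) :=
    isPrimitive_algEqNeNeGe.irreducible_iff_irreducible_map_fraction_map.1 irreducible_algEqNeNeGe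
  rw [← minpoly.eq_of_irreducible irreducible_map aeval_genLaurentNeNeGe,
    leadingCoeff_map_of_injective (IsFractionRing.injective ℚ[X] ℚ⟮X⟯), leadingCoeff_algEqNeNeGe,
    mul_left_comm, ← C_mul, mul_inv_cancel₀ algebraMap_leadingPoly_ne_zero, C_1, mul_one]

theorem natDegree_minpoly_genLaurentNeNeGe :
    (minpoly ℚ⟮X⟯ genLaurentNeNeGe).natDegree = 4 := by
  rw [← natDegree_C_mul algebraMap_leadingPoly_ne_zero, ← map_algEqNeNeGe_eq_C_mul_minpoly,
    natDegree_map_eq_of_injective (IsFractionRing.injective _ _), natDegree_algEqNeNeGe]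

theorem isAlgebraic_genLaurentNeNeGe : IsAlgebraic ℚ⟮X⟯ genLaurentNeNeGe :=
  ⟨_, (Polynomial.map_ne_zero_iff (IsFractionRing.injective _ _)).2 irreducible_algEqNeNeGe.ne_zero,
    aeval_genLaurentNeNeGe⟩

end MinimalPolynomial

theorem mainTheorem7 :
    -- the triple of relations and the set of patterns have the same avoiders
    (∀ n : ℕ, classNeNeGe n =
      patternAvoiders n ({![0, 1, 0], ![1, 0, 1], ![1, 2, 0], ![2, 0, 1], ![2, 1, 0]} :
        Set (Fin 3 → ℕ))) ∧
    -- the two power-series roots of the quartic kernel, and the generating function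
    kernelPoly.natDegree = 4 ∧
    (∃ X₁ X₃ : PowerSeries ℝ,
      X₁ ≠ X₃ ∧
      (∀ Y : PowerSeries ℝ, kernelPoly.IsRoot Y ↔ Y = X₁ ∨ Y = X₃) ∧
      (∀ n : ℕ, PowerSeries.coeff n X₁ ∈ IntermediateField.adjoin ℚ {(√5 : ℝ)} ∧
        PowerSeries.coeff n X₃ ∈ IntermediateField.adjoin ℚ {(√5 : ℝ)}) ∧
      -- closed forms; `S₁`, `S₃` are the square roots with constant term `2`
      (∃ S₁ S₃ : PowerSeries ℝ,
        PowerSeries.constantCoeff S₁ = 2 ∧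
        PowerSeries.constantCoeff S₃ = 2 ∧
        S₁ ^ 2 = PowerSeries.C (-2 * (√5 - 3)) * PowerSeries.X ^ 2
          - PowerSeries.C (4 * (√5 + 3)) * PowerSeries.X + 4 ∧
        S₃ ^ 2 = PowerSeries.C (2 * (√5 + 3)) * PowerSeries.X ^ 2
          + PowerSeries.C (4 * (√5 - 3)) * PowerSeries.X + 4 ∧
        4 * PowerSeries.X * X₁ =
          -S₁ - PowerSeries.C √5 * PowerSeries.X + PowerSeries.X + 2 ∧
        4 * PowerSeries.X * X₃ =
          -S₃ + PowerSeries.C √5 * PowerSeries.X + PowerSeries.X + 2) ∧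
      -- initial terms
      (List.range 6).map (fun n => PowerSeries.coeff n X₁) =
        [1, 1 / 2 * (1 + √5), 2 + √5, 7 + 3 * √5, 25 + 11 * √5, 96 + 43 * √5] ∧
      (List.range 6).map (fun n => PowerSeries.coeff n X₃) =
        [1, 1 / 2 * (1 - √5), 2 - √5, 7 - 3 * √5, 25 - 11 * √5, 96 - 43 * √5] ∧
      -- the denominator is a unit, so the quotient is a genuine one
      PowerSeries.constantCoeff (X₁ * X₃ * PowerSeries.X ^ 2 - X₁ * PowerSeries.X
        - X₃ * PowerSeries.X - PowerSeries.X + 1) ≠ 0 ∧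
      genFunNeNeGe ℝ =
        -((X₁ * PowerSeries.X + X₃ * PowerSeries.X - 1) *
          (X₁ * X₃ * PowerSeries.X ^ 2 - X₁ * PowerSeries.X - X₃ * PowerSeries.X
            - PowerSeries.X + 1)⁻¹)) ∧
    (List.range 11).map (fun n => (classNeNeGe n).ncard) =
      [1, 1, 2, 5, 15, 51, 188, 733, 2979, 12495, 53708] ∧
    -- algebraic of degree 4 over `ℚ(z)`, with explicit minimal polynomial up to normalization
    IsAlgebraic (RatFunc ℚ) genLaurentNeNeGe ∧
    (minpoly (RatFunc ℚ) genLaurentNeNeGe).natDegree = 4 ∧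
    algEqNeNeGe.map (algebraMap (Polynomial ℚ) (RatFunc ℚ)) =
      Polynomial.C (algebraMap (Polynomial ℚ) (RatFunc ℚ)
        (4 * Polynomial.X ^ 3 - 2 * Polynomial.X ^ 2 + Polynomial.X)) *
        minpoly (RatFunc ℚ) genLaurentNeNeGe := by
  refine ⟨classNeNeGe_eq_patternAvoiders, natDegree_kernelPoly,
    ⟨kernelRoot Real.goldenRatio, kernelRoot Real.goldenConj,
      kernelRoot_goldenRatio_ne_kernelRoot_goldenConj,
      isRoot_kernelPoly_iff Real.goldenRatio_add_goldenConj Real.goldenRatio_mul_goldenConj,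
      fun n => ⟨?_, ?_⟩,
      ⟨kernelSqrt Real.goldenRatio, kernelSqrt Real.goldenConj, constantCoeff_kernelSqrt _,
        constantCoeff_kernelSqrt _, kernelSqrt_goldenRatio_sq, kernelSqrt_goldenConj_sq,
        four_mul_X_mul_kernelRoot_goldenRatio, four_mul_X_mul_kernelRoot_goldenConj⟩,
      coeff_kernelRoot_goldenRatio_initial, coeff_kernelRoot_goldenConj_initial, by simp,
      genFunNeNeGe_eq_neg_mul_inv Real.goldenRatio_add_goldenConj Real.goldenRatio_mul_goldenConj
        goldenRatio_ne_goldenConj⟩,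
    ncard_classNeNeGe_initial, isAlgebraic_genLaurentNeNeGe, natDegree_minpoly_genLaurentNeNeGe,
    map_algEqNeNeGe_eq_C_mul_minpoly⟩
  · exact coeff_kernelRoot_mem goldenRatio_mem_adjoin_sqrt_five n
  · exact coeff_kernelRoot_mem goldenConj_mem_adjoin_sqrt_five n
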